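/- All graphs are finite and simple. For a connected graph $\Gamma$ with distance $d_\Gamma$ and a positive integer $k$, a set $S\subseteq V(\Gamma)$ is a *$k$-metric generator* for $\Gamma$ if for any two different vertices $u,v$ of $\Gamma$ there are at least $k$ vertices $w\in S$ with $d_\Gamma(u,w)\ne d_\Gamma(v,w)$; the *$k$-metric dimension* $\dim_k(\Gamma)$ is the minimum cardinality of a $k$-metric generator for $\Gamma$. For a graph $G$ with vertices $v_1,\dots,v_n$ and a family $\mathcal H=\{H_1,\dots,H_n\}$ of graphs, the *corona product* $G\odot\mathcal H$ is obtained from one copy of $G$ and one copy of each $H_i$ by joining $v_i$ by an edge to every vertex of $H_i$, $i=1,\dots,n$. Write $\overline{\mathcal H}=\{\overline{H_1},\dots,\overline{H_n}\}$ for the family of the complements, and $K_1\diamond\mathcal H=\{K_1+H_1,\dots,K_1+H_n\}$, where $K_1+H_i$ is the graph obtained from $H_i$ by adding one new vertex adjacent to all the vertices of $H_i$. **Proposition.** Let $G$ be a connected graph of order $n\ge 2$ and let $\mathcal H=\{H_1,\dots,H_n\}$ be a family of $n$ cycles, where $H_i$ has order $n_i\ge 7$ for every $i\in\{1,\dots,n\}$.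 Then for each $k\in\{1,2,3,4\}$ the $k$-metric dimensions below exist, and 1. $\dim_1(G\odot\mathcal H)=\dim_1(G\odot\overline{\mathcal H})=\dim_1(G\odot(K_1\diamond\mathcal H))=\sum_{i=1}^n\left\lfloor\frac{2n_i+2}{5}\right\rfloor$; 2. $\dim_2(G\odot\mathcal H)=\dim_2(G\odot\overline{\mathcal H})=\dim_2(G\odot(K_1\diamond\mathcal H))=\sum_{i=1}^n\left\lceil\frac{n_i}{2}\right\rceil$; 3. $\dim_3(G\odot\mathcal H)=\dim_3(G\odot\overline{\mathcal H})=\dim_3(G\odot(K_1\diamond\mathcal H))=\sum_{i=1}^n\left(n_i-\left\lfloor\frac{n_i}{5}\right\rfloor\right)$; 4. $\dim_4(G\odot\mathcal H)=\dim_4(G\odot\overline{\mathcal H})=\dim_4(G\odot(K_1\diamond\mathcal H))=\sum_{i=1}^n n_i$. -/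

import Mathlib

namespace CoronaMetricDim

/-- A set `S` of vertices is a `k`-metric generator for the (connected) graph `G` if any two
different vertices are distinguished, through their graph distances, by at least `k` elements
of `S`. -/
def IsKMetricGenerator {V : Type*} (G : SimpleGraph V) (k : ℕ) (S : Set V) : Prop :=
  ∀ u v : V, u ≠ v → (k : ℕ∞) ≤ {w | w ∈ S ∧ G.dist u w ≠ G.dist v w}.encard

/-- The `k`-metric dimension `dim_k(G)`: the minimum cardinality of a `k`-metric generator.
It takes the value `⊤` when there is no `k`-metric generator, so that an equation
`kMetricDim G k = d` with `d` a natural number contains the existence of a `k`-metric basis. -/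
noncomputable def kMetricDim {V : Type*} (G : SimpleGraph V) (k : ℕ) : ℕ∞ :=
  ⨅ (S : Set V) (_ : IsKMetricGenerator G k S), S.encard

/-- The join graph `G + H`: the disjoint union of `G` and `H` together with all the edges between
a vertex of `G` and a vertex of `H`. -/
def join {V W : Type*} (G : SimpleGraph V) (H : SimpleGraph W) : SimpleGraph (V ⊕ W) :=
  (G ⊕g H) ⊔ completeBipartiteGraph V W

/-- The cone `K₁ + H`. -/
def cone {W : Type*} (H : SimpleGraph W) : SimpleGraph (Unit ⊕ W) :=
  join (⊤ : SimpleGraph Unit) H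

/-- The corona product `G ⊙ 𝓗` of a graph `G` and a family `𝓗` of graphs indexed by the vertices
of `G`: one copy of `G` and of every `H v`, with `v` joined to every vertex of `H v`. -/
def corona {V : Type*} (G : SimpleGraph V) {W : V → Type*} (H : (v : V) → SimpleGraph (W v)) :
    SimpleGraph (V ⊕ (Σ v, W v)) where
  Adj
    | Sum.inl u, Sum.inl v => G.Adj u v
    | Sum.inl u, Sum.inr y => u = y.1
    | Sum.inr x, Sum.inl v => x.1 = v
    | Sum.inr x, Sum.inr y =>
        ∃ (v : V) (a b : W v), (H v).Adj a b ∧ x = ⟨v, a⟩ ∧ y = ⟨v, b⟩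
  symm.symm
    | Sum.inl _, Sum.inl _ => fun h => G.adj_symm h
    | Sum.inl _, Sum.inr _ => fun h => Eq.symm h
    | Sum.inr _, Sum.inl _ => fun h => Eq.symm h
    | Sum.inr _, Sum.inr _ => fun ⟨v, a, b, h, hx, hy⟩ => ⟨v, b, a, h.symm, hy, hx⟩
  loopless.irrefl
    | Sum.inl _ => fun h => G.loopless.irrefl _ h
    | Sum.inr _ => fun ⟨v, a, b, h, hx, hy⟩ => by
        subst hx
        have hab : a = b := by simpa using hy
        exact h.ne hab

end CoronaMetricDim

/-! In a corona product a fibre `H v` meets the rest of the graph only through the root `v`. Hence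
two vertices of the same fibre are equidistant from everything outside it, and inside it their
distances are the distances of `H v` truncated at 2. A `k`-metric generator therefore restricts on
every fibre to a `k`-adjacency generator (pairs separated by the truncated distance). Conversely, a
union of `k`-adjacency generators also separates every other pair, because some single fibre
separates it with all its chosen vertices. So the `k`-metric dimension is the sum of the
`k`-adjacency dimensions of the fibres (`kMetricDim_corona`).

The `k`-adjacency dimension does not change under complementation. It does not change under adding
an apex either, provided it is at least `k` plus the maximum degree. For cycles this requirement is
`k + 2`, and order 7 makes it hold, with equality at order 7 for `k = 1` and `k = 2`.

It remains to find the `k`-adjacency dimension of a cycle for `k ≤ 4`. The separating sets are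
windows: four consecutive vertices, five consecutive vertices without the middle one, or two
disjoint triples (`isKAdjGenerator_cycleGraph_iff`). Lower bounds come from summing a window
inequality over all rotations; upper bounds come from explicit, nearly periodic sets. -/

namespace CoronaMetricDim

open SimpleGraph

/-- The vertices that distinguish `u` from `v` through the distance truncated at `2`. -/
def adjSep {W : Type*} (H : SimpleGraph W) (u v : W) : Set W :=
  {w | w = u ∨ w = v ∨ ¬(H.Adj u w ↔ H.Adj v w)}

/-- `S` is a `k`-adjacency generator for `H`: any two different vertices are distinguished by at
least `k` elements of `S` through the distance truncated at `2`. -/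
def IsKAdjGenerator {W : Type*} (H : SimpleGraph W) (k : ℕ) (S : Set W) : Prop :=
  ∀ u v : W, u ≠ v → (k : ℕ∞) ≤ (S ∩ adjSep H u v).encard

/-- The minimum cardinality of a `k`-adjacency generator for `H` is `a`. -/
structure HasAdjDim {W : Type*} (H : SimpleGraph W) (k a : ℕ) : Prop where
  lower : ∀ S, IsKAdjGenerator H k S → (a : ℕ∞) ≤ S.encard
  attained : ∃ S, IsKAdjGenerator H k S ∧ S.encard = a

/-! ### Distances in the corona product and reduction to the fibres. -/

section Corona

variable {V : Type*} {G : SimpleGraph V} {W : V → Type*} {H : (v : V) → SimpleGraph (W v)}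

lemma corona_adj_inl_inr {u v : V} {x : W v} :
    (corona G H).Adj (Sum.inl u) (Sum.inr ⟨v, x⟩) ↔ u = v := Iff.rfl

lemma corona_adj_inr_inl {u v : V} {x : W v} :
    (corona G H).Adj (Sum.inr ⟨v, x⟩) (Sum.inl u) ↔ v = u := Iff.rfl

lemma corona_adj_inr_inr {v : V} {x y : W v} :
    (corona G H).Adj (Sum.inr ⟨v, x⟩) (Sum.inr ⟨v, y⟩) ↔ (H v).Adj x y := by
  constructor
  · rintro ⟨t, a, b, h, hx, hy⟩
    cases hx
    cases hy
    exact h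
  · exact fun h => ⟨v, x, y, h, rfl, rfl⟩

lemma corona_connected (hG : G.Connected) : (corona G H).Connected := by
  have hbase : ∀ u v : V, (corona G H).Reachable (Sum.inl u) (Sum.inl v) := fun u v =>
    (hG.preconnected u v).map (⟨Sum.inl, fun h => h⟩ : G →g corona G H)
  have hroot : ∀ z, ∃ v : V, (corona G H).Reachable z (Sum.inl v) := by
    rintro (v | ⟨v, x⟩)
    · exact ⟨v, Reachable.refl _⟩
    · exact ⟨v, Adj.reachable (corona_adj_inr_inl.2 rfl)⟩
  obtain ⟨v⟩ := hG.nonempty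
  have : Nonempty (V ⊕ (Σ v, W v)) := ⟨Sum.inl v⟩
  refine ⟨fun y z => ?_⟩
  obtain ⟨u, hu⟩ := hroot y
  obtain ⟨v, hv⟩ := hroot z
  exact hu.trans ((hbase u v).trans hv.symm)

lemma dist_inl_inr_self {v : V} {x : W v} :
    (corona G H).dist (Sum.inl v) (Sum.inr ⟨v, x⟩) = 1 :=
  dist_eq_one_iff_adj.2 (corona_adj_inl_inr.2 rfl)

/-- The root `v` separates its fibre from the rest: each step of a walk starting in the fibre either
stays there or goes to `v`. -/
lemma dist_inl_succ_le_length {v : V} {y z : V ⊕ (Σ v, W v)} (p : (corona G H).Walk y z)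
    (hz : ∀ x : W v, z ≠ Sum.inr ⟨v, x⟩) (x : W v) (hy : y = Sum.inr ⟨v, x⟩) :
    (corona G H).dist (Sum.inl v) z + 1 ≤ p.length := by
  induction p generalizing x with
  | nil => exact absurd hy (hz x)
  | @cons a b _ h q ih =>
    subst hy
    rw [Walk.length_cons]
    rcases b with u | ⟨u, x'⟩
    · obtain rfl : v = u := h
      exact Nat.succ_le_succ (dist_le q)
    · obtain ⟨t, a, b, -, hx, hy⟩ := h
      cases hx
      cases hy
      exact (ih hz b rfl).trans (Nat.le_succ _)

lemma dist_inr_eq_succ (hG : G.Connected) {v : V} (x : W v) {z : V ⊕ (Σ v, W v)}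
    (hz : ∀ x : W v, z ≠ Sum.inr ⟨v, x⟩) :
    (corona G H).dist (Sum.inr ⟨v, x⟩) z = (corona G H).dist (Sum.inl v) z + 1 := by
  have hC := corona_connected (H := H) hG
  obtain ⟨p, hp⟩ := hC.exists_walk_length_eq_dist (Sum.inr ⟨v, x⟩) z
  have h1 := dist_inl_succ_le_length p hz x rfl
  have h2 := hC.dist_triangle (u := Sum.inr ⟨v, x⟩) (v := Sum.inl v) (w := z)
  rw [(corona G H).dist_comm (u := Sum.inr ⟨v, x⟩) (v := Sum.inl v), dist_inl_inr_self] at h2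
  omega

lemma dist_inl_inr_eq_succ (hG : G.Connected) {u v : V} (x : W v) :
    (corona G H).dist (Sum.inl u) (Sum.inr ⟨v, x⟩) =
      (corona G H).dist (Sum.inl u) (Sum.inl v) + 1 := by
  rw [dist_comm, dist_inr_eq_succ hG x (by simp), dist_comm]

lemma two_le_dist_inl_inr (hG : G.Connected) {u v : V} (h : u ≠ v) (x : W v) :
    2 ≤ (corona G H).dist (Sum.inl u) (Sum.inr ⟨v, x⟩) := by
  rw [dist_inl_inr_eq_succ hG]
  have := (corona_connected (H := H) hG).pos_dist_of_ne
    (u := Sum.inl u) (v := Sum.inl v) (by simpa using h)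
  omega

lemma three_le_dist_inr_inr (hG : G.Connected) {u v : V} (h : u ≠ v) (y : W u) (x : W v) :
    3 ≤ (corona G H).dist (Sum.inr ⟨u, y⟩) (Sum.inr ⟨v, x⟩) := by
  rw [dist_inr_eq_succ hG y (by
    intro z hz
    simp only [Sum.inr.injEq, Sigma.mk.injEq] at hz
    exact h hz.1.symm)]
  have := two_le_dist_inl_inr (H := H) hG h x
  omega

lemma dist_inr_inr_same (hG : G.Connected) {v : V} (x y : W v) :
    ((corona G H).dist (Sum.inr ⟨v, x⟩) (Sum.inr ⟨v, y⟩) = 0 ↔ x = y) ∧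
    ((corona G H).dist (Sum.inr ⟨v, x⟩) (Sum.inr ⟨v, y⟩) = 1 ↔ (H v).Adj x y) ∧
    (corona G H).dist (Sum.inr ⟨v, x⟩) (Sum.inr ⟨v, y⟩) ≤ 2 := by
  have hC := corona_connected (H := H) hG
  refine ⟨?_, ?_, ?_⟩
  · rw [hC.dist_eq_zero_iff]
    simp
  · rw [dist_eq_one_iff_adj, corona_adj_inr_inr]
  · have h2 := hC.dist_triangle (u := Sum.inr ⟨v, x⟩) (v := Sum.inl v) (w := Sum.inr ⟨v, y⟩)
    rw [(corona G H).dist_comm (u := Sum.inr ⟨v, x⟩) (v := Sum.inl v), dist_inl_inr_self,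
      dist_inl_inr_self] at h2
    exact h2

/-- The detour through the root bounds distances within a fibre by 2, so only equality and adjacency
matter. -/
lemma dist_inr_ne_iff_mem_adjSep (hG : G.Connected) {v : V} (x y w : W v) :
    (corona G H).dist (Sum.inr ⟨v, x⟩) (Sum.inr ⟨v, w⟩) ≠
      (corona G H).dist (Sum.inr ⟨v, y⟩) (Sum.inr ⟨v, w⟩) ↔
    x ≠ y ∧ w ∈ adjSep (H v) x y := by
  obtain ⟨h1, h2, h3⟩ := dist_inr_inr_same (H := H) hG x w
  obtain ⟨h4, h5, h6⟩ := dist_inr_inr_same (H := H) hG y w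
  have h7 : w = x → w = y → x = y := fun a b => a.symm.trans b
  simp only [adjSep, Set.mem_ofPred_eq]
  rw [← h2, ← h5, eq_comm (a := w) (b := x), eq_comm (a := w) (b := y)] at *
  constructor
  · intro h
    refine ⟨fun he => h (by rw [he]), ?_⟩
    rw [← h1, ← h4]
    omega
  · rintro ⟨hne, h⟩
    rw [← h1, ← h4] at h
    have : ¬ ((corona G H).dist (Sum.inr ⟨v, x⟩) (Sum.inr ⟨v, w⟩) = 0 ∧
        (corona G H).dist (Sum.inr ⟨v, y⟩) (Sum.inr ⟨v, w⟩) = 0) := by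
      rw [h1, h4]
      exact fun ⟨a, b⟩ => hne (h7 a b)
    omega

/-- The inclusion of the `v`-th fibre into the corona product. -/
def fibre (v : V) (x : W v) : V ⊕ (Σ v, W v) := Sum.inr ⟨v, x⟩

lemma fibre_injective (v : V) : Function.Injective (fibre v : W v → V ⊕ (Σ v, W v)) := by
  intro x y h
  simpa [fibre] using h

lemma encard_iUnion_fibre [Fintype V] (T : (v : V) → Set (W v)) :
    (⋃ v, fibre v '' T v).encard = ∑ v, (T v).encard := by
  rw [Set.encard_iUnion_of_finite, finsum_eq_sum_of_fintype]
  · exact Finset.sum_congr rfl fun v _ => (fibre_injective v).encard_image _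
  · intro u v huv
    rw [Function.onFun, Set.disjoint_left]
    rintro _ ⟨x, -, rfl⟩ ⟨y, -, h⟩
    simp only [fibre, Sum.inr.injEq, Sigma.mk.injEq] at h
    exact huv h.1.symm

/-- Vertices outside the fibre see all of it at one and the same distance, so they separate no pair
within it. -/
lemma IsKMetricGenerator.isKAdjGenerator_preimage (hG : G.Connected) {k : ℕ}
    {S : Set (V ⊕ (Σ v, W v))} (hS : IsKMetricGenerator (corona G H) k S) (v : V) :
    IsKAdjGenerator (H v) k (fibre v ⁻¹' S) := by
  intro x y hxy
  refine (hS (fibre v x) (fibre v y) ((fibre_injective v).ne hxy)).trans ?_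
  rw [← (fibre_injective v).encard_image]
  refine Set.encard_le_encard ?_
  rintro w ⟨hw, hd⟩
  by_cases hz : ∃ z : W v, w = Sum.inr ⟨v, z⟩
  · obtain ⟨z, rfl⟩ := hz
    exact ⟨z, ⟨hw, ((dist_inr_ne_iff_mem_adjSep hG x y z).1 hd).2⟩, rfl⟩
  · push Not at hz
    exact absurd ((dist_inr_eq_succ hG x hz).trans (dist_inr_eq_succ hG y hz).symm) hd

/-- A pair not contained in one fibre is separated by every vertex of some fibre, and `hk` says that
enough vertices are chosen there. -/
lemma isKMetricGenerator_iUnion_fibre [Nontrivial V] (hG : G.Connected) {k : ℕ}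
    {T : (v : V) → Set (W v)} (hT : ∀ v, IsKAdjGenerator (H v) k (T v))
    (hk : ∀ v, (k : ℕ∞) ≤ (T v).encard) :
    IsKMetricGenerator (corona G H) k (⋃ v, fibre v '' T v) := by
  have key : ∀ (v : V) (a b : V ⊕ (Σ v, W v)),
      (∀ x, (corona G H).dist a (fibre v x) ≠ (corona G H).dist b (fibre v x)) →
      (k : ℕ∞) ≤ {w | w ∈ ⋃ v, fibre v '' T v ∧
        (corona G H).dist a w ≠ (corona G H).dist b w}.encard := by
    intro v a b h
    refine (hk v).trans ?_
    rw [← (fibre_injective v).encard_image]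
    refine Set.encard_le_encard ?_
    rintro _ ⟨x, hx, rfl⟩
    exact ⟨Set.mem_iUnion.2 ⟨v, x, hx, rfl⟩, h x⟩
  have mixed : ∀ (u v : V) (x : W v), (k : ℕ∞) ≤ {w | w ∈ ⋃ v, fibre v '' T v ∧
        (corona G H).dist (Sum.inl u) w ≠ (corona G H).dist (Sum.inr ⟨v, x⟩) w}.encard := by
    intro u v x
    by_cases huv : u = v
    · subst huv
      -- The fibre of `u` itself need not separate `u` from a vertex attached to it; any other fibre
      -- does, the distances from it differing by exactly 1.
      obtain ⟨t, ht⟩ := exists_ne u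
      refine key t _ _ fun y => ?_
      rw [dist_inr_eq_succ hG x (by
        intro z hz
        simp only [fibre, Sum.inr.injEq, Sigma.mk.injEq] at hz
        exact ht hz.1)]
      omega
    · refine key u _ _ fun y => ?_
      have h1 := three_le_dist_inr_inr (H := H) hG (Ne.symm huv) x y
      have h2 := dist_inl_inr_self (G := G) (H := H) (x := y)
      simp only [fibre]
      omega
  rintro (u | ⟨u, x⟩) (v | ⟨v, y⟩) hne
  · refine key u _ _ fun y => ?_
    have h1 := dist_inl_inr_self (G := G) (H := H) (x := y)
    have h2 := two_le_dist_inl_inr (H := H) hG (u := v) (v := u) (by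
      rintro rfl
      exact hne rfl) y
    simp only [fibre]
    omega
  · exact mixed u v y
  · simpa only [ne_comm] using mixed v u x
  · by_cases huv : u = v
    · subst huv
      have hxy : x ≠ y := by
        rintro rfl
        exact hne rfl
      refine (hT u x y hxy).trans ?_
      rw [← (fibre_injective u).encard_image]
      refine Set.encard_le_encard ?_
      rintro _ ⟨z, ⟨hz, hs⟩, rfl⟩
      exact ⟨Set.mem_iUnion.2 ⟨u, z, hz, rfl⟩,
        (dist_inr_ne_iff_mem_adjSep hG x y z).2 ⟨hxy, hs⟩⟩
    · refine key u _ _ fun z => ?_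
      have h1 := three_le_dist_inr_inr (H := H) hG (Ne.symm huv) y z
      have h2 := (dist_inr_inr_same (H := H) hG x z).2.2
      simp only [fibre]
      omega

theorem kMetricDim_corona [Fintype V] [Nontrivial V] (hG : G.Connected) {k : ℕ} {a : V → ℕ}
    (hH : ∀ v, HasAdjDim (H v) k (a v)) (hk : ∀ v, k ≤ a v) :
    kMetricDim (corona G H) k = ((∑ v, a v : ℕ) : ℕ∞) := by
  push_cast
  apply le_antisymm
  · choose T hT hcard using fun v => (hH v).attained
    refine (iInf₂_le _ (isKMetricGenerator_iUnion_fibre hG hT ?_)).trans ?_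
    · intro v
      rw [hcard]
      exact_mod_cast hk v
    · rw [encard_iUnion_fibre]
      simp [hcard]
  · refine le_iInf₂ fun S hS => ?_
    refine (Finset.sum_le_sum fun v _ =>
      (hH v).lower _ (hS.isKAdjGenerator_preimage hG v)).trans ?_
    rw [← encard_iUnion_fibre]
    exact Set.encard_le_encard (Set.iUnion_subset fun v => Set.image_preimage_subset _ _)

end Corona

/-! ### Invariance of the adjacency dimension: isomorphism, complement, apex. -/

section Transfer

variable {W W' : Type*} {H : SimpleGraph W} {H' : SimpleGraph W'} {k a : ℕ}

lemma IsKAdjGenerator.image_iso (e : H ≃g H') {S : Set W} (hS : IsKAdjGenerator H k S) :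
    IsKAdjGenerator H' k (e '' S) := by
  intro u v huv
  refine (hS (e.symm u) (e.symm v) (e.symm.injective.ne huv)).trans ?_
  rw [← e.injective.encard_image]
  refine Set.encard_le_encard ?_
  rintro _ ⟨x, ⟨hx, hs⟩, rfl⟩
  refine ⟨⟨x, hx, rfl⟩, ?_⟩
  have h1 : ∀ t, H.Adj (e.symm t) x ↔ H'.Adj t (e x) := fun t => by
    rw [← e.map_adj_iff, e.apply_symm_apply]
  have h2 : ∀ t, x = e.symm t ↔ e x = t := fun t => e.toEquiv.eq_symm_apply
  simpa only [adjSep, Set.mem_ofPred_eq, h1, h2] using hs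

lemma HasAdjDim.of_iso (e : H ≃g H') (h : HasAdjDim H' k a) : HasAdjDim H k a := by
  obtain ⟨hl, S, hS, hc⟩ := h
  refine ⟨fun T hT => ?_, e.symm '' S, hS.image_iso e.symm, ?_⟩
  · rw [← e.injective.encard_image]
    exact hl _ (hT.image_iso e)
  · rw [e.symm.injective.encard_image, hc]

/-- Away from `u` and `v` both adjacencies are negated, so their disagreement persists; `u` and `v`
belong to both sets anyway. -/
lemma adjSep_compl (u v : W) : adjSep Hᶜ u v = adjSep H u v := by
  ext w
  simp only [adjSep, Set.mem_ofPred_eq, compl_adj]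
  grind

lemma HasAdjDim.compl (h : HasAdjDim H k a) : HasAdjDim Hᶜ k a := by
  obtain ⟨hl, S, hS, hc⟩ := h
  refine ⟨fun T hT => hl T ?_, S, ?_, hc⟩
  · simpa only [IsKAdjGenerator, adjSep_compl] using hT
  · simpa only [IsKAdjGenerator, adjSep_compl] using hS

lemma cone_adj_inl_inr {x : Unit} {y : W} : (cone H).Adj (Sum.inl x) (Sum.inr y) := by
  simp [cone, join]

lemma cone_adj_inr_inr {x y : W} : (cone H).Adj (Sum.inr x) (Sum.inr y) ↔ H.Adj x y := by
  simp [cone, join]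

lemma inr_mem_adjSep_cone {x y w : W} :
    Sum.inr w ∈ adjSep (cone H) (Sum.inr x) (Sum.inr y) ↔ w ∈ adjSep H x y := by
  simp only [adjSep, Set.mem_ofPred_eq, Sum.inr.injEq, cone_adj_inr_inr]

lemma inl_notMem_adjSep_cone {x y : W} {w : Unit} :
    Sum.inl w ∉ adjSep (cone H) (Sum.inr x) (Sum.inr y) := by
  simp [adjSep, (cone H).adj_comm (Sum.inr _) (Sum.inl _), cone_adj_inl_inr]

lemma inr_mem_adjSep_cone_apex {x w : W} {y : Unit} (h : ¬ H.Adj x w) :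
    Sum.inr w ∈ adjSep (cone H) (Sum.inl y) (Sum.inr x) := by
  simp [adjSep, cone_adj_inl_inr, cone_adj_inr_inr, h]

lemma adjSep_comm (u v : W) : adjSep H u v = adjSep H v u := by
  ext w
  simp only [adjSep, Set.mem_ofPred_eq]
  grind

/-- Adding an apex to a graph of maximum degree at most `d` keeps its `k`-adjacency dimension,
when this is at least `k + d`. -/
lemma HasAdjDim.cone {d : ℕ} (hd : ∀ x, {w | H.Adj x w}.encard ≤ d) (hka : k + d ≤ a)
    (h : HasAdjDim H k a) : HasAdjDim (cone H) k a := by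
  obtain ⟨hl, S, hS, hc⟩ := h
  have hinj : Function.Injective (Sum.inr : W → Unit ⊕ W) := Sum.inr_injective
  refine ⟨fun T hT => ?_, Sum.inr '' S, ?_, ?_⟩
  · refine (hl (Sum.inr ⁻¹' T) fun x y hxy => ?_).trans ?_
    · refine (hT _ _ (hinj.ne hxy)).trans ?_
      rw [← hinj.encard_image]
      refine Set.encard_le_encard ?_
      rintro (w | w) ⟨hw, hs⟩
      · exact absurd hs inl_notMem_adjSep_cone
      · exact ⟨w, ⟨hw, inr_mem_adjSep_cone.1 hs⟩, rfl⟩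
    · rw [← hinj.encard_image]
      exact Set.encard_le_encard (Set.image_preimage_subset _ _)
  · have apex : ∀ x : W, ∀ y : Unit,
        (k : ℕ∞) ≤ (Sum.inr '' S ∩ adjSep (CoronaMetricDim.cone H) (Sum.inl y)
          (Sum.inr x)).encard := by
      intro x y
      -- The apex is adjacent to all of `W`, so every non-neighbour of `x` in `S` (possibly `x`
      -- itself) separates it from `x`; at most `d` elements of `S` are lost.
      have h1 : (k : ℕ∞) ≤ (S \ {w | H.Adj x w}).encard := by
        have h2 := Set.encard_le_encard_sdiff_add_encard S {w | H.Adj x w}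
        have h3 : ((k + d : ℕ) : ℕ∞) ≤ (S \ {w | H.Adj x w}).encard + d := by
          refine le_trans ?_ (h2.trans (add_le_add le_rfl (hd x)))
          rw [hc]
          exact_mod_cast hka
        rw [Nat.cast_add] at h3
        exact (ENat.add_le_add_iff_right (ENat.natCast_ne_top d)).1 h3
      refine h1.trans ?_
      rw [← hinj.encard_image]
      refine Set.encard_le_encard ?_
      rintro _ ⟨w, ⟨hw, hn⟩, rfl⟩
      exact ⟨⟨w, hw, rfl⟩, inr_mem_adjSep_cone_apex hn⟩
    rintro (x | x) (y | y) hxy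
    · exact absurd rfl hxy
    · exact apex y x
    · rw [adjSep_comm]
      exact apex x y
    · refine (hS x y fun h => hxy (by rw [h])).trans ?_
      rw [← hinj.encard_image]
      refine Set.encard_le_encard ?_
      rintro _ ⟨w, ⟨hw, hs⟩, rfl⟩
      exact ⟨⟨w, hw, rfl⟩, inr_mem_adjSep_cone.2 hs⟩
  · rw [hinj.encard_image, hc]

end Transfer

/-! ### Adjacency generators of cycles as window conditions. -/

section Cycle

open Fin.CommRing

/-- The number of elements of `S`, zero or one, at the vertex `i`. -/
def ind {A : Type*} [DecidableEq A] (S : Finset A) (i : A) : ℕ := if i ∈ S then 1 else 0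

lemma ind_le_one {A : Type*} [DecidableEq A] (S : Finset A) (i : A) : ind S i ≤ 1 := by
  unfold ind
  split <;> omega

lemma encard_inter_eq_sum_ind {A : Type*} [DecidableEq A] (S F : Finset A) :
    ((S : Set A) ∩ (F : Set A)).encard = ((∑ i ∈ F, ind S i : ℕ) : ℕ∞) := by
  rw [← Finset.coe_inter, Set.encard_coe_eq_coe_finsetCard, Finset.inter_comm,
    ← Finset.filter_mem_eq_inter, Finset.card_filter]
  rfl

/-- The hypotheses make the listed vertices pairwise distinct, so no term of the sum collapses;
likewise for the next two lemmas. -/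
lemma sum_window_one {A : Type*} [CommRing A] [DecidableEq A] (f : A → ℕ)
    (h1 : (1 : A) ≠ 0) (h2 : (2 : A) ≠ 0) (h3 : (3 : A) ≠ 0)
    (i : A) :
    ∑ x ∈ ({i, i + 1, i + 2, i + 3} : Finset A), f x =
      f i + f (i + 1) + f (i + 2) + f (i + 3) := by
  repeat rw [Finset.sum_insert]
  · rw [Finset.sum_singleton]
    ring
  all_goals
    simp only [Finset.mem_insert, Finset.mem_singleton, not_or]
    repeat' apply And.intro
    all_goals intro he
    all_goals first
      | exact h1 (by linear_combination he)
      | exact h1 (by linear_combination -he)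
      | exact h2 (by linear_combination he)
      | exact h2 (by linear_combination -he)
      | exact h3 (by linear_combination he)
      | exact h3 (by linear_combination -he)

lemma sum_window_two {A : Type*} [CommRing A] [DecidableEq A] (f : A → ℕ)
    (h1 : (1 : A) ≠ 0) (h2 : (2 : A) ≠ 0) (h3 : (3 : A) ≠ 0)
    (h4 : (4 : A) ≠ 0)
    (i : A) :
    ∑ x ∈ ({i, i + 1, i + 3, i + 4} : Finset A), f x =
      f i + f (i + 1) + f (i + 3) + f (i + 4) := by
  repeat rw [Finset.sum_insert]
  · rw [Finset.sum_singleton]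
    ring
  all_goals
    simp only [Finset.mem_insert, Finset.mem_singleton, not_or]
    repeat' apply And.intro
    all_goals intro he
    all_goals first
      | exact h1 (by linear_combination he)
      | exact h1 (by linear_combination -he)
      | exact h2 (by linear_combination he)
      | exact h2 (by linear_combination -he)
      | exact h3 (by linear_combination he)
      | exact h3 (by linear_combination -he)
      | exact h4 (by linear_combination he)
      | exact h4 (by linear_combination -he)

lemma sum_window_far {A : Type*} [CommRing A] [DecidableEq A] (f : A → ℕ)
    (h1 : (1 : A) ≠ 0) (h2 : (2 : A) ≠ 0)
    {i j : A} (h : j ≠ i ∧ j ≠ i + 1 ∧ j ≠ i + 2 ∧ i ≠ j + 1 ∧ i ≠ j + 2) :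
    ∑ x ∈ ({i, i + 1, i + 2, j, j + 1, j + 2} : Finset A), f x =
      (f i + f (i + 1) + f (i + 2)) + (f j + f (j + 1) + f (j + 2)) := by
  repeat rw [Finset.sum_insert]
  · rw [Finset.sum_singleton]
    ring
  all_goals
    simp only [Finset.mem_insert, Finset.mem_singleton, not_or]
    repeat' apply And.intro
    all_goals intro he
    all_goals first
      | exact h1 (by linear_combination he)
      | exact h1 (by linear_combination -he)
      | exact h2 (by linear_combination he)
      | exact h2 (by linear_combination -he)
      | exact h.1 (by linear_combination he)
      | exact h.1 (by linear_combination -he)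
      | exact h.2.1 (by linear_combination he)
      | exact h.2.1 (by linear_combination -he)
      | exact h.2.2.1 (by linear_combination he)
      | exact h.2.2.1 (by linear_combination -he)
      | exact h.2.2.2.1 (by linear_combination he)
      | exact h.2.2.2.1 (by linear_combination -he)
      | exact h.2.2.2.2 (by linear_combination he)

variable {m : ℕ}

lemma natCast_ne_zero_of_lt (c : ℕ) (h1 : 1 ≤ c) (h2 : c ≤ 6) : (c : Fin (m + 7)) ≠ 0 := by
  intro h
  have := congrArg Fin.val h
  rw [Fin.val_natCast, Nat.mod_eq_of_lt (by omega)] at this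
  simp at this
  omega

lemma numerals_ne_zero : (1 : Fin (m + 7)) ≠ 0 ∧ (2 : Fin (m + 7)) ≠ 0 ∧
    (3 : Fin (m + 7)) ≠ 0 ∧ (4 : Fin (m + 7)) ≠ 0 ∧ (5 : Fin (m + 7)) ≠ 0 := by
  have h := natCast_ne_zero_of_lt (m := m)
  exact ⟨mod_cast h 1 (by norm_num) (by norm_num), mod_cast h 2 (by norm_num) (by norm_num),
    mod_cast h 3 (by norm_num) (by norm_num), mod_cast h 4 (by norm_num) (by norm_num),
    mod_cast h 5 (by norm_num) (by norm_num)⟩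

lemma cycleGraph_adj_iff {u w : Fin (m + 7)} :
    (cycleGraph (m + 7)).Adj u w ↔ w = u + 1 ∨ w = u - 1 := by
  rw [cycleGraph_adj]
  constructor <;> rintro (h | h)
  · right; rw [← h]; ring
  · left; rw [← h]; ring
  · right; rw [h]; ring
  · left; rw [h]; ring

lemma adjSep_cycleGraph_one (i : Fin (m + 7)) :
    adjSep (cycleGraph (m + 7)) (i + 1) (i + 2) =
      (({i, i + 1, i + 2, i + 3} : Finset (Fin (m + 7))) : Set (Fin (m + 7))) := by
  obtain ⟨h1, h2, h3, h4, h5⟩ := numerals_ne_zero (m := m)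
  ext w
  simp only [adjSep, Set.mem_ofPred_eq, cycleGraph_adj_iff, Finset.coe_insert,
    Finset.coe_singleton, Set.mem_insert_iff, Set.mem_singleton_iff]
  obtain ⟨d, rfl⟩ : ∃ d, w = i + d := ⟨w - i, by ring⟩
  grind

/-- The common neighbour `i + 2` separates nothing and drops out. -/
lemma adjSep_cycleGraph_two (i : Fin (m + 7)) :
    adjSep (cycleGraph (m + 7)) (i + 1) (i + 3) =
      (({i, i + 1, i + 3, i + 4} : Finset (Fin (m + 7))) : Set (Fin (m + 7))) := by
  obtain ⟨h1, h2, h3, h4, h5⟩ := numerals_ne_zero (m := m)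
  ext w
  simp only [adjSep, Set.mem_ofPred_eq, cycleGraph_adj_iff, Finset.coe_insert,
    Finset.coe_singleton, Set.mem_insert_iff, Set.mem_singleton_iff]
  obtain ⟨d, rfl⟩ : ∃ d, w = i + d := ⟨w - i, by ring⟩
  grind

/-- At cyclic distance at least 3 the closed neighbourhoods are disjoint, and both count in full. -/
lemma adjSep_cycleGraph_far {i j : Fin (m + 7)} (h : j ≠ i ∧ j ≠ i + 1 ∧ j ≠ i + 2 ∧
    i ≠ j + 1 ∧ i ≠ j + 2) :
    adjSep (cycleGraph (m + 7)) (i + 1) (j + 1) =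
      (({i, i + 1, i + 2, j, j + 1, j + 2} : Finset (Fin (m + 7))) : Set (Fin (m + 7))) := by
  obtain ⟨h1, h2, h3, h4, h5⟩ := numerals_ne_zero (m := m)
  ext w
  simp only [adjSep, Set.mem_ofPred_eq, cycleGraph_adj_iff, Finset.coe_insert,
    Finset.coe_singleton, Set.mem_insert_iff, Set.mem_singleton_iff]
  grind

/-- The `k`-adjacency generators of a cycle of order at least `7`, in terms of windows. -/
lemma isKAdjGenerator_cycleGraph_iff {k : ℕ} {S : Finset (Fin (m + 7))} :
    IsKAdjGenerator (cycleGraph (m + 7)) k (S : Set (Fin (m + 7))) ↔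
      (∀ i, k ≤ ind S i + ind S (i + 1) + ind S (i + 2) + ind S (i + 3)) ∧
      (∀ i, k ≤ ind S i + ind S (i + 1) + ind S (i + 3) + ind S (i + 4)) ∧
      ∀ i j, (j ≠ i ∧ j ≠ i + 1 ∧ j ≠ i + 2 ∧ i ≠ j + 1 ∧ i ≠ j + 2) →
        k ≤ (ind S i + ind S (i + 1) + ind S (i + 2)) +
          (ind S j + ind S (j + 1) + ind S (j + 2)) := by
  obtain ⟨h1, h2, h3, h4, -⟩ := numerals_ne_zero (m := m)
  have w1 : ∀ i, (k : ℕ∞) ≤ ((S : Set (Fin (m + 7))) ∩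
      adjSep (cycleGraph (m + 7)) (i + 1) (i + 2)).encard ↔
      k ≤ ind S i + ind S (i + 1) + ind S (i + 2) + ind S (i + 3) := fun i => by
    rw [adjSep_cycleGraph_one, encard_inter_eq_sum_ind, sum_window_one _ h1 h2 h3, Nat.cast_le]
  have w2 : ∀ i, (k : ℕ∞) ≤ ((S : Set (Fin (m + 7))) ∩
      adjSep (cycleGraph (m + 7)) (i + 1) (i + 3)).encard ↔
      k ≤ ind S i + ind S (i + 1) + ind S (i + 3) + ind S (i + 4) := fun i => by
    rw [adjSep_cycleGraph_two, encard_inter_eq_sum_ind, sum_window_two _ h1 h2 h3 h4,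
      Nat.cast_le]
  have w3 : ∀ i j, (j ≠ i ∧ j ≠ i + 1 ∧ j ≠ i + 2 ∧ i ≠ j + 1 ∧ i ≠ j + 2) →
      ((k : ℕ∞) ≤ ((S : Set (Fin (m + 7))) ∩
        adjSep (cycleGraph (m + 7)) (i + 1) (j + 1)).encard ↔
      k ≤ (ind S i + ind S (i + 1) + ind S (i + 2)) +
          (ind S j + ind S (j + 1) + ind S (j + 2))) := fun i j h => by
    rw [adjSep_cycleGraph_far h, encard_inter_eq_sum_ind, sum_window_far _ h1 h2 h, Nat.cast_le]
  constructor
  · intro h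
    refine ⟨fun i => (w1 i).1 (h _ _ fun he => h1 ?_), fun i => (w2 i).1 (h _ _ fun he => h2 ?_),
      fun i j hij => (w3 i j hij).1 (h _ _ fun he => hij.1 (add_right_cancel he).symm)⟩
    · linear_combination -he
    · linear_combination -he
  · rintro ⟨g1, g2, g3⟩ u v huv
    obtain ⟨i, rfl⟩ : ∃ i, u = i + 1 := ⟨u - 1, by ring⟩
    obtain ⟨j, rfl⟩ : ∃ j, v = j + 1 := ⟨v - 1, by ring⟩
    have hne : j ≠ i := fun h => huv (by rw [h])
    by_cases c1 : j = i + 1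
    · subst c1
      convert (w1 i).2 (g1 i) using 4
      ring
    by_cases c2 : j = i + 2
    · subst c2
      convert (w2 i).2 (g2 i) using 4
      ring
    by_cases c3 : i = j + 1
    · subst c3
      rw [adjSep_comm]
      convert (w1 j).2 (g1 j) using 4
      ring
    by_cases c4 : i = j + 2
    · subst c4
      rw [adjSep_comm]
      convert (w2 j).2 (g2 j) using 4
      ring
    exact (w3 i j ⟨hne, c1, c2, c3, c4⟩).2 (g3 i j ⟨hne, c1, c2, c3, c4⟩)

/-! ### Tools for counting over rotations and for explicit sets. -/

lemma sum_ind_add (S : Finset (Fin (m + 7))) (c : Fin (m + 7)) :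
    ∑ i, ind S (i + c) = S.card := by
  refine (Equiv.sum_comp (Equiv.addRight c) (ind S)).trans ?_
  simp [ind]

lemma sum_ind (S : Finset (Fin (m + 7))) : ∑ i, ind S i = S.card := by
  simp [ind]

lemma hasAdjDim_cycleGraph {k a : ℕ}
    (hl : ∀ S : Finset (Fin (m + 7)),
      IsKAdjGenerator (cycleGraph (m + 7)) k (S : Set (Fin (m + 7))) → a ≤ S.card)
    (hu : ∃ S : Finset (Fin (m + 7)),
      IsKAdjGenerator (cycleGraph (m + 7)) k (S : Set (Fin (m + 7))) ∧ S.card ≤ a) :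
    HasAdjDim (cycleGraph (m + 7)) k a := by
  classical
  refine ⟨fun S hS => ?_, ?_⟩
  · rw [← Set.coe_toFinset S] at hS ⊢
    rw [Set.encard_coe_eq_coe_finsetCard]
    exact_mod_cast hl _ hS
  · obtain ⟨S, hS, hc⟩ := hu
    refine ⟨S, hS, ?_⟩
    rw [Set.encard_coe_eq_coe_finsetCard, le_antisymm hc (hl S hS)]

/-- The five cases record where a run of five vertices wraps past the end, which turns window
conditions into linear arithmetic on naturals. -/
lemma val_add_numerals (i : Fin (m + 7)) :
    (i.val + 4 < m + 7 ∧ (i + 1).val = i.val + 1 ∧ (i + 2).val = i.val + 2 ∧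
      (i + 3).val = i.val + 3 ∧ (i + 4).val = i.val + 4) ∨
    (i.val + 4 = m + 7 ∧ (i + 1).val = i.val + 1 ∧ (i + 2).val = i.val + 2 ∧
      (i + 3).val = i.val + 3 ∧ (i + 4).val = 0) ∨
    (i.val + 3 = m + 7 ∧ (i + 1).val = i.val + 1 ∧ (i + 2).val = i.val + 2 ∧
      (i + 3).val = 0 ∧ (i + 4).val = 1) ∨
    (i.val + 2 = m + 7 ∧ (i + 1).val = i.val + 1 ∧ (i + 2).val = 0 ∧
      (i + 3).val = 1 ∧ (i + 4).val = 2) ∨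
    (i.val + 1 = m + 7 ∧ (i + 1).val = 0 ∧ (i + 2).val = 1 ∧ (i + 3).val = 2 ∧ (i + 4).val = 3) := by
  have key : ∀ c : ℕ, c < m + 7 → (i + (c : Fin (m + 7))).val =
      if i.val + c < m + 7 then i.val + c else i.val + c - (m + 7) := fun c hc => by
    rw [Fin.val_add_eq_ite, Fin.val_natCast, Nat.mod_eq_of_lt hc]
    split_ifs <;> omega
  have v1 : (i + 1).val = _ := mod_cast key 1 (by omega)
  have v2 : (i + 2).val = _ := mod_cast key 2 (by omega)
  have v3 : (i + 3).val = _ := mod_cast key 3 (by omega)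
  have v4 : (i + 4).val = _ := mod_cast key 4 (by omega)
  have hi := i.isLt
  rw [v1, v2, v3, v4]
  split_ifs <;> omega

lemma ind_filter (P : ℕ → Prop) [DecidablePred P] (i : Fin (m + 7)) :
    ind (Finset.univ.filter fun i : Fin (m + 7) => P i.val) i = if P i.val then 1 else 0 := by
  simp [ind]

lemma card_filter_le_of_injOn {P : ℕ → Prop} [DecidablePred P] {a : ℕ} (g : ℕ → ℕ)
    (hg : ∀ i, i < m + 7 → P i → g i < a)
    (hinj : ∀ i j, i < m + 7 → j < m + 7 → P i → P j → g i = g j → i = j) :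
    (Finset.univ.filter fun i : Fin (m + 7) => P i.val).card ≤ a := by
  rw [← Finset.card_range a]
  refine Finset.card_le_card_of_injOn (fun i => g i.val) ?_ ?_
  · intro i hi
    simp only [Finset.coe_filter, Finset.mem_univ, true_and, Set.mem_ofPred_eq] at hi
    simpa using hg i.val i.isLt hi
  · intro i hi j hj h
    simp only [Finset.coe_filter, Finset.mem_univ, true_and, Set.mem_ofPred_eq] at hi hj
    exact Fin.ext (hinj _ _ i.isLt j.isLt hi hj h)

/-! ### The `k`-adjacency dimensions of cycles for `k = 4, 2, 3, 1`. -/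

theorem hasAdjDim_cycleGraph_four : HasAdjDim (cycleGraph (m + 7)) 4 (m + 7) := by
  refine hasAdjDim_cycleGraph (fun S hS => ?_) ⟨Finset.univ, ?_, by simp⟩
  · have h1 := (isKAdjGenerator_cycleGraph_iff.1 hS).1
    have h := Finset.sum_le_sum fun i (_ : i ∈ Finset.univ) => h1 i
    simp only [Finset.sum_add_distrib, sum_ind_add, sum_ind, Finset.sum_const, Finset.card_univ,
      Fintype.card_fin, smul_eq_mul] at h
    omega
  · rw [isKAdjGenerator_cycleGraph_iff]
    simp [ind]

theorem hasAdjDim_cycleGraph_two : HasAdjDim (cycleGraph (m + 7)) 2 ((m + 7 + 1) / 2) := by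
  refine hasAdjDim_cycleGraph (fun S hS => ?_)
    ⟨Finset.univ.filter fun i : Fin (m + 7) => i.val % 2 = 0, ?_, ?_⟩
  · have h1 := (isKAdjGenerator_cycleGraph_iff.1 hS).1
    have h := Finset.sum_le_sum fun i (_ : i ∈ Finset.univ) => h1 i
    simp only [Finset.sum_add_distrib, sum_ind_add, sum_ind, Finset.sum_const, Finset.card_univ,
      Fintype.card_fin, smul_eq_mul] at h
    omega
  · set S := Finset.univ.filter fun i : Fin (m + 7) => i.val % 2 = 0 with hS
    -- The even positions meet every edge, also the closing one since 0 is even; each window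
    -- contains two disjoint edges.
    have cover : ∀ i, 1 ≤ ind S i + ind S (i + 1) := fun i => by
      have h1 := val_add_numerals i
      rw [hS, ind_filter (fun t => t % 2 = 0), ind_filter (fun t => t % 2 = 0)]
      split_ifs <;> omega
    have e3 : ∀ i : Fin (m + 7), i + 2 + 1 = i + 3 := fun i => by ring
    have e4 : ∀ i : Fin (m + 7), i + 3 + 1 = i + 4 := fun i => by ring
    rw [isKAdjGenerator_cycleGraph_iff]
    refine ⟨fun i => ?_, fun i => ?_, fun i j _ => ?_⟩
    · have h1 := cover i
      have h2 := cover (i + 2)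
      rw [e3] at h2
      omega
    · have h1 := cover i
      have h2 := cover (i + 3)
      rw [e4] at h2
      omega
    · have h1 := cover i
      have h2 := cover j
      omega
  · exact card_filter_le_of_injOn (P := fun t => t % 2 = 0) (fun t => t / 2)
      (fun i hi h => by omega) (fun i j _ _ h1 h2 h => by omega)

theorem hasAdjDim_cycleGraph_three :
    HasAdjDim (cycleGraph (m + 7)) 3 (m + 7 - (m + 7) / 5) := by
  refine hasAdjDim_cycleGraph (fun S hS => ?_)
    ⟨Finset.univ.filter fun i : Fin (m + 7) => ¬(i.val % 5 = 0 ∧ i.val + 5 ≤ m + 7), ?_, ?_⟩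
  · obtain ⟨h1, h2, -⟩ := isKAdjGenerator_cycleGraph_iff.1 hS
    -- Any two of five consecutive vertices lie in a common window of four (the punctured one for
    -- the two ends), and each window may miss only one vertex. Summing gives `5 * |S| ≥ 4 * (m +
    -- 7)`.
    have h5 : ∀ i, 4 ≤ ind S i + ind S (i + 1) + ind S (i + 2) + ind S (i + 3) +
        ind S (i + 4) := fun i => by
      have a1 := h1 i
      have a2 := h1 (i + 1)
      have a3 := h2 i
      rw [show i + 1 + 1 = i + 2 by ring, show i + 1 + 2 = i + 3 by ring,
        show i + 1 + 3 = i + 4 by ring] at a2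
      have b0 := ind_le_one S i
      have b1 := ind_le_one S (i + 1)
      have b2 := ind_le_one S (i + 2)
      have b3 := ind_le_one S (i + 3)
      have b4 := ind_le_one S (i + 4)
      omega
    have h := Finset.sum_le_sum fun i (_ : i ∈ Finset.univ) => h5 i
    simp only [Finset.sum_add_distrib, sum_ind_add, sum_ind, Finset.sum_const, Finset.card_univ,
      Fintype.card_fin, smul_eq_mul] at h
    omega
  -- Every fifth vertex is omitted; `i.val + 5 ≤ m + 7` keeps the last omitted vertex at least 5
  -- away from 0 around the cycle.
  · set S := Finset.univ.filter fun i : Fin (m + 7) =>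
      ¬(i.val % 5 = 0 ∧ i.val + 5 ≤ m + 7) with hS
    have h5 : ∀ i, 4 ≤ ind S i + ind S (i + 1) + ind S (i + 2) + ind S (i + 3) +
        ind S (i + 4) := fun i => by
      have hv := val_add_numerals i
      simp only [hS, ind_filter (fun t => ¬(t % 5 = 0 ∧ t + 5 ≤ m + 7)), ite_not]
      rcases hv with ⟨h, h1, h2, h3, h4⟩ | ⟨h, h1, h2, h3, h4⟩ | ⟨h, h1, h2, h3, h4⟩ |
        ⟨h, h1, h2, h3, h4⟩ | ⟨h, h1, h2, h3, h4⟩ <;> rw [h1, h2, h3, h4] <;> split_ifs <;>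
        first | omega | tauto
    have hle := ind_le_one S
    rw [isKAdjGenerator_cycleGraph_iff]
    refine ⟨fun i => ?_, fun i => ?_, fun i j _ => ?_⟩
    · have := h5 i
      have := hle (i + 4)
      omega
    · have := h5 i
      have := hle (i + 2)
      omega
    · have := h5 i
      have := h5 j
      have := hle (i + 3)
      have := hle (i + 4)
      have := hle (j + 3)
      have := hle (j + 4)
      omega
  · have hc := Finset.card_filter_add_card_filter_not (s := (Finset.univ : Finset (Fin (m + 7))))
      (fun i : Fin (m + 7) => i.val % 5 = 0 ∧ i.val + 5 ≤ m + 7)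
    have hM : (m + 7) / 5 ≤ (Finset.univ.filter fun i : Fin (m + 7) =>
        i.val % 5 = 0 ∧ i.val + 5 ≤ m + 7).card := by
      rw [← Finset.card_range ((m + 7) / 5)]
      refine Finset.card_le_card_of_injOn (fun j => Fin.ofNat (m + 7) (5 * j)) ?_ ?_
      · intro j hj
        have hj : j < (m + 7) / 5 := by simpa using hj
        have : 5 * j < m + 7 := by omega
        simp only [Finset.coe_filter, Finset.mem_univ, true_and, Set.mem_ofPred_eq, Fin.val_ofNat,
          Nat.mod_eq_of_lt this]
        omega
      · intro j hj l hl h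
        have hj : j < (m + 7) / 5 := by simpa using hj
        have hl : l < (m + 7) / 5 := by simpa using hl
        have h := congrArg Fin.val h
        simp only [Fin.val_ofNat] at h
        rw [Nat.mod_eq_of_lt (by omega), Nat.mod_eq_of_lt (by omega)] at h
        omega
    simp only [Finset.card_univ, Fintype.card_fin] at hc
    omega

lemma le_card_of_isKAdjGenerator_one {S : Finset (Fin (m + 7))}
    (hS : IsKAdjGenerator (cycleGraph (m + 7)) 1 (S : Set (Fin (m + 7)))) :
    (2 * (m + 7) + 2) / 5 ≤ S.card := by
  obtain ⟨h1, h2, h3⟩ := isKAdjGenerator_cycleGraph_iff.1 hS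
  -- `E` collects the starts of triples missed by `S`. There is at most one: two overlapping ones
  -- would give a missed run of four, and two disjoint ones violate the far condition.
  set E : Finset (Fin (m + 7)) := Finset.univ.filter fun i =>
    ind S i + ind S (i + 1) + ind S (i + 2) = 0 with hE
  have hEcard : E.card ≤ 1 := by
    refine Finset.card_le_one.2 fun i hi j hj => ?_
    simp only [hE, Finset.mem_filter, Finset.mem_univ, true_and] at hi hj
    by_contra hne
    have n1 : ∀ i, ind S i + ind S (i + 1) + ind S (i + 2) = 0 →
        ind S (i + 1) + ind S (i + 1 + 1) + ind S (i + 1 + 2) ≠ 0 := fun i hi => by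
      have := h1 i
      rw [show i + 1 + 2 = i + 3 by ring]
      omega
    have n2 : ∀ i, ind S i + ind S (i + 1) + ind S (i + 2) = 0 →
        ind S (i + 2) + ind S (i + 2 + 1) + ind S (i + 2 + 2) ≠ 0 := fun i hi => by
      have := h1 i
      rw [show i + 2 + 1 = i + 3 by ring]
      omega
    have := h3 i j ⟨fun h => hne h.symm, fun h => n1 i hi (h ▸ hj), fun h => n2 i hi (h ▸ hj),
      fun h => n1 j hj (h ▸ hi), fun h => n2 j hj (h ▸ hi)⟩
    omega
  -- The windows force a lone element of a run of five into its second or fourth place, leaving a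
  -- missed triple at the end or the start. Summing gives `2 * (m + 7) ≤ 5 * |S| + 2`.
  have hw : ∀ i, 2 ≤ ind S i + ind S (i + 1) + ind S (i + 2) + ind S (i + 3) + ind S (i + 4) +
      (ind E i + ind E (i + 2)) := fun i => by
    have a1 := h1 i
    have a2 := h1 (i + 1)
    have a3 := h2 i
    rw [show i + 1 + 1 = i + 2 by ring, show i + 1 + 2 = i + 3 by ring,
      show i + 1 + 3 = i + 4 by ring] at a2
    have c1 : ind S i + ind S (i + 1) + ind S (i + 2) = 0 → ind E i = 1 := fun h => by
      have hm : i ∈ E := by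
        rw [hE, Finset.mem_filter]
        exact ⟨Finset.mem_univ _, h⟩
      exact if_pos hm
    have c2 : ind S (i + 2) + ind S (i + 3) + ind S (i + 4) = 0 → ind E (i + 2) = 1 :=
      fun h => by
        rw [show i + 3 = i + 2 + 1 by ring, show i + 4 = i + 2 + 2 by ring] at h
        have hm : i + 2 ∈ E := by
          rw [hE, Finset.mem_filter]
          exact ⟨Finset.mem_univ _, h⟩
        exact if_pos hm
    omega
  have h := Finset.sum_le_sum fun i (_ : i ∈ Finset.univ) => hw i
  simp only [Finset.sum_add_distrib, sum_ind_add, sum_ind, Finset.sum_const, Finset.card_univ,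
    Fintype.card_fin, smul_eq_mul] at h
  omega

/-- Here `c` is the only permitted start of a missed triple, so two different triples are never both
missed and the far condition follows. -/
lemma isKAdjGenerator_one_of_windows {P : ℕ → Prop} [DecidablePred P] (c : ℕ)
    (hP : ∀ i x1 x2 x3 x4 : ℕ,
      ((i + 4 < m + 7 ∧ x1 = i + 1 ∧ x2 = i + 2 ∧
          x3 = i + 3 ∧ x4 = i + 4) ∨
        (i + 4 = m + 7 ∧ x1 = i + 1 ∧ x2 = i + 2 ∧
          x3 = i + 3 ∧ x4 = 0) ∨
        (i + 3 = m + 7 ∧ x1 = i + 1 ∧ x2 = i + 2 ∧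
          x3 = 0 ∧ x4 = 1) ∨
        (i + 2 = m + 7 ∧ x1 = i + 1 ∧ x2 = 0 ∧
          x3 = 1 ∧ x4 = 2) ∨
        (i + 1 = m + 7 ∧ x1 = 0 ∧ x2 = 1 ∧ x3 = 2 ∧ x4 = 3)) →
      (P i ∨ P x1 ∨ P x2 ∨ P x3) ∧ (P i ∨ P x1 ∨ P x3 ∨ P x4) ∧
      (P i ∨ P x1 ∨ P x2 ∨ i = c)) :
    IsKAdjGenerator (cycleGraph (m + 7)) 1
      ((Finset.univ.filter fun i : Fin (m + 7) => P i.val : Finset (Fin (m + 7))) :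
        Set (Fin (m + 7))) := by
  have h : ∀ i : Fin (m + 7), _ := fun i => hP i.val _ _ _ _ (val_add_numerals i)
  rw [isKAdjGenerator_cycleGraph_iff]
  simp only [ind_filter P]
  refine ⟨fun i => ?_, fun i => ?_, fun i j hij => ?_⟩
  · obtain ⟨h1, -, -⟩ := h i
    split_ifs <;> first | omega | (exfalso; tauto)
  · obtain ⟨-, h1, -⟩ := h i
    split_ifs <;> first | omega | (exfalso; tauto)
  · by_contra! hlt
    have hi : i.val = c := by
      obtain ⟨-, -, h1⟩ := h i
      rcases h1 with h1 | h1 | h1 | h1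
      · rw [if_pos h1] at hlt
        omega
      · rw [if_pos h1] at hlt
        omega
      · rw [if_pos h1] at hlt
        omega
      · exact h1
    have hj : j.val = c := by
      obtain ⟨-, -, h1⟩ := h j
      rcases h1 with h1 | h1 | h1 | h1
      · rw [if_pos h1] at hlt
        omega
      · rw [if_pos h1] at hlt
        omega
      · rw [if_pos h1] at hlt
        omega
      · exact h1
    exact hij.1 (Fin.ext (hj.trans hi.symm))

theorem hasAdjDim_cycleGraph_one :
    HasAdjDim (cycleGraph (m + 7)) 1 ((2 * (m + 7) + 2) / 5) := by
  refine hasAdjDim_cycleGraph (fun S hS => le_card_of_isKAdjGenerator_one hS) ?_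
  -- Residues 1 and 3 mod 5 give alternating gaps 2 and 3. When the order is 3 mod 5, two gaps of 3
  -- would meet around the vertex `m + 5` and leave its punctured window empty. The pattern is then
  -- shifted to 0, 2, 4, 7, 9, …, with a single gap of 4 before returning to 0. The maps given to
  -- `card_filter_le_of_injOn` number the chosen vertices in order.
  by_cases hr : (m + 7) % 5 = 3
  · refine ⟨_, isKAdjGenerator_one_of_windows
        (P := fun t => t = 0 ∨ (2 ≤ t ∧ t + 1 < m + 7 ∧ (t % 5 = 2 ∨ t % 5 = 4))) (m + 4) ?_,
      card_filter_le_of_injOn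
        (P := fun t => t = 0 ∨ (2 ≤ t ∧ t + 1 < m + 7 ∧ (t % 5 = 2 ∨ t % 5 = 4)))
        (fun t => if t = 0 then 0 else 1 + 2 * (t / 5) + (t % 5 - 2) / 2)
        ?_ ?_⟩
    · rintro i x1 x2 x3 x4 (⟨h, rfl, rfl, rfl, rfl⟩ | ⟨h, rfl, rfl, rfl, rfl⟩ |
        ⟨h, rfl, rfl, rfl, rfl⟩ | ⟨h, rfl, rfl, rfl, rfl⟩ | ⟨h, rfl, rfl, rfl, rfl⟩) <;>
        omega
    · intro i hi h
      split_ifs <;> omega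
    · intro i j hi hj h1 h2 h
      split_ifs at h <;> omega
  · refine ⟨_, isKAdjGenerator_one_of_windows (P := fun t => t % 5 = 1 ∨ t % 5 = 3) (m + 5) ?_,
      card_filter_le_of_injOn (P := fun t => t % 5 = 1 ∨ t % 5 = 3)
        (fun t => 2 * (t / 5) + (t % 5) / 2) ?_ ?_⟩
    · rintro i x1 x2 x3 x4 (⟨h, rfl, rfl, rfl, rfl⟩ | ⟨h, rfl, rfl, rfl, rfl⟩ |
        ⟨h, rfl, rfl, rfl, rfl⟩ | ⟨h, rfl, rfl, rfl, rfl⟩ | ⟨h, rfl, rfl, rfl, rfl⟩) <;>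
        omega
    · intro i hi h
      omega
    · intro i j hi hj h1 h2 h
      omega

lemma encard_neighbors_cycleGraph_le (x : Fin (m + 7)) :
    {w | (cycleGraph (m + 7)).Adj x w}.encard ≤ (2 : ℕ) := by
  have h : {w | (cycleGraph (m + 7)).Adj x w} = {x + 1, x - 1} := by
    ext w
    exact cycleGraph_adj_iff
  rw [h]
  refine (Set.encard_insert_le _ _).trans ?_
  rw [Set.encard_singleton]
  norm_num

end Cycle

/-- The common value of the `k`-metric dimension of the three corona products built from a family
of cycles of order at least `7`. -/
theorem kMetricDim_corona_cycles {V : Type*} [Fintype V] [Nontrivial V] {G : SimpleGraph V}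
    (hG : G.Connected) {W : V → Type*} {H : (v : V) → SimpleGraph (W v)} {n : V → ℕ}
    (hn : ∀ v, 7 ≤ n v) (hH : ∀ v, Nonempty (H v ≃g cycleGraph (n v))) {k : ℕ} {f : ℕ → ℕ}
    (hf : ∀ m, HasAdjDim (cycleGraph (m + 7)) k (f (m + 7))) (hk : ∀ m, k + 2 ≤ f (m + 7))
    {g : V → ℕ} (hg : ∀ v, g v = f (n v)) :
    kMetricDim (corona G H) k = kMetricDim (corona G fun v => (H v)ᶜ) k ∧
      kMetricDim (corona G fun v => (H v)ᶜ) k = kMetricDim (corona G fun v => cone (H v)) k ∧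
      kMetricDim (corona G fun v => cone (H v)) k = ((∑ v, g v : ℕ) : ℕ∞) := by
  -- The 2 is the degree of a cycle, the loss allowed for when an apex is added.
  have hle : ∀ v, k + 2 ≤ g v := fun v => by
    obtain ⟨m, hm⟩ := Nat.exists_eq_add_of_le' (hn v)
    rw [hg, hm]
    exact hk m
  have hdim : ∀ v, HasAdjDim (H v) k (g v) ∧ HasAdjDim (cone (H v)) k (g v) := fun v => by
    obtain ⟨m, hm⟩ := Nat.exists_eq_add_of_le' (hn v)
    obtain ⟨e⟩ := hH v
    have hv := hle v
    rw [hg] at hv ⊢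
    rw [hm] at e hv ⊢
    refine ⟨(hf m).of_iso e, ((hf m).of_iso e).cone (d := 2) (fun x => ?_) hv⟩
    rw [← e.injective.encard_image]
    refine le_trans (Set.encard_le_encard ?_) (encard_neighbors_cycleGraph_le (e x))
    rintro _ ⟨w, hw, rfl⟩
    exact e.map_adj_iff.2 hw
  have hk' : ∀ v, k ≤ g v := fun v => by
    have := hle v
    omega
  rw [kMetricDim_corona hG (fun v => (hdim v).1) hk',
    kMetricDim_corona hG (fun v => (hdim v).1.compl) hk',
    kMetricDim_corona hG (fun v => (hdim v).2) hk']
  exact ⟨rfl, rfl, rfl⟩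

/-! ### Rational floors and ceilings as natural division. -/

lemma floor_two_mul_add_two_div_five (n : ℕ) :
    ⌊(2 * (n : ℚ) + 2) / 5⌋₊ = (2 * n + 2) / 5 := by
  rw [← Nat.floor_div_eq_div (K := ℚ)]
  push_cast
  rfl

lemma ceil_div_two (n : ℕ) : ⌈(n : ℚ) / 2⌉₊ = (n + 1) / 2 := by
  apply le_antisymm
  · rw [Nat.ceil_le, div_le_iff₀ two_pos]
    have h : n ≤ (n + 1) / 2 * 2 := by omega
    exact_mod_cast h
  · have h1 := Nat.le_ceil ((n : ℚ) / 2)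
    rw [div_le_iff₀ two_pos] at h1
    have h : n ≤ ⌈(n : ℚ) / 2⌉₊ * 2 := by exact_mod_cast h1
    omega

lemma floor_div_five (n : ℕ) : ⌊(n : ℚ) / 5⌋₊ = n / 5 := by
  rw [← Nat.floor_div_eq_div (K := ℚ)]
  push_cast
  rfl

end CoronaMetricDim

theorem mainTheorem11 {V : Type*} [Fintype V] (G : SimpleGraph V) (hG : G.Connected)
    (hV : 2 ≤ Fintype.card V) {W : V → Type*} (H : (v : V) → SimpleGraph (W v)) (n : V → ℕ)
    (hn : ∀ v, 7 ≤ n v) (hH : ∀ v, Nonempty (H v ≃g SimpleGraph.cycleGraph (n v))) :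
    (CoronaMetricDim.kMetricDim (CoronaMetricDim.corona G H) 1
        = CoronaMetricDim.kMetricDim (CoronaMetricDim.corona G fun v => (H v)ᶜ) 1 ∧
      CoronaMetricDim.kMetricDim (CoronaMetricDim.corona G fun v => (H v)ᶜ) 1
        = CoronaMetricDim.kMetricDim
            (CoronaMetricDim.corona G fun v => CoronaMetricDim.cone (H v)) 1 ∧
      CoronaMetricDim.kMetricDim
            (CoronaMetricDim.corona G fun v => CoronaMetricDim.cone (H v)) 1
        = ((∑ v, ⌊(2 * (n v : ℚ) + 2) / 5⌋₊ : ℕ) : ℕ∞)) ∧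
    (CoronaMetricDim.kMetricDim (CoronaMetricDim.corona G H) 2
        = CoronaMetricDim.kMetricDim (CoronaMetricDim.corona G fun v => (H v)ᶜ) 2 ∧
      CoronaMetricDim.kMetricDim (CoronaMetricDim.corona G fun v => (H v)ᶜ) 2
        = CoronaMetricDim.kMetricDim
            (CoronaMetricDim.corona G fun v => CoronaMetricDim.cone (H v)) 2 ∧
      CoronaMetricDim.kMetricDim
            (CoronaMetricDim.corona G fun v => CoronaMetricDim.cone (H v)) 2
        = ((∑ v, ⌈(n v : ℚ) / 2⌉₊ : ℕ) : ℕ∞)) ∧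
    (CoronaMetricDim.kMetricDim (CoronaMetricDim.corona G H) 3
        = CoronaMetricDim.kMetricDim (CoronaMetricDim.corona G fun v => (H v)ᶜ) 3 ∧
      CoronaMetricDim.kMetricDim (CoronaMetricDim.corona G fun v => (H v)ᶜ) 3
        = CoronaMetricDim.kMetricDim
            (CoronaMetricDim.corona G fun v => CoronaMetricDim.cone (H v)) 3 ∧
      CoronaMetricDim.kMetricDim
            (CoronaMetricDim.corona G fun v => CoronaMetricDim.cone (H v)) 3
        = ((∑ v, (n v - ⌊(n v : ℚ) / 5⌋₊) : ℕ) : ℕ∞)) ∧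
    (CoronaMetricDim.kMetricDim (CoronaMetricDim.corona G H) 4
        = CoronaMetricDim.kMetricDim (CoronaMetricDim.corona G fun v => (H v)ᶜ) 4 ∧
      CoronaMetricDim.kMetricDim (CoronaMetricDim.corona G fun v => (H v)ᶜ) 4
        = CoronaMetricDim.kMetricDim
            (CoronaMetricDim.corona G fun v => CoronaMetricDim.cone (H v)) 4 ∧
      CoronaMetricDim.kMetricDim
            (CoronaMetricDim.corona G fun v => CoronaMetricDim.cone (H v)) 4
        = ((∑ v, n v : ℕ) : ℕ∞)) := by
  have : Nontrivial V := Fintype.one_lt_card_iff_nontrivial.1 hV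
  refine ⟨?_, ?_, ?_, ?_⟩
  · exact CoronaMetricDim.kMetricDim_corona_cycles hG hn hH (f := fun n => (2 * n + 2) / 5)
      (fun _ => CoronaMetricDim.hasAdjDim_cycleGraph_one) (fun m => by omega)
      (fun v => CoronaMetricDim.floor_two_mul_add_two_div_five (n v))
  · exact CoronaMetricDim.kMetricDim_corona_cycles hG hn hH (f := fun n => (n + 1) / 2)
      (fun _ => CoronaMetricDim.hasAdjDim_cycleGraph_two) (fun m => by omega)
      (fun v => CoronaMetricDim.ceil_div_two (n v))
  · exact CoronaMetricDim.kMetricDim_corona_cycles hG hn hH (f := fun n => n - n / 5)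
      (fun _ => CoronaMetricDim.hasAdjDim_cycleGraph_three) (fun m => by omega)
      (fun v => by rw [CoronaMetricDim.floor_div_five])
  · exact CoronaMetricDim.kMetricDim_corona_cycles hG hn hH (f := fun n => n)
      (fun _ => CoronaMetricDim.hasAdjDim_cycleGraph_four) (fun m => by omega)
      (fun v => rfl)
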